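/- Let $d\ge 2$ and $n\ge 2$ be integers and $\omega=e^{2\pi i/d}$. For an integer $m\ge 1$ let $$|G_n^{m}\rangle = Z_e^{m}\,|+\rangle^{\otimes n}=\frac{1}{\sqrt{d^n}}\sum_{q_1,\dots,q_n=0}^{d-1}\omega^{m\,q_1\cdots q_n}\,|q_1\dots q_n\rangle\in(\mathbb C^d)^{\otimes n}$$ be the $n$-qudit elementary hypergraph state of multiplicity $m$, where $|+\rangle=d^{-1/2}\sum_{q=0}^{d-1}|q\rangle$ and $Z_e|q_1\dots q_n\rangle=\omega^{q_1\cdots q_n}|q_1\dots q_n\rangle$. For $|\psi\rangle\in(\mathbb C^d)^{\otimes n}$ let $$E(|\psi\rangle)=\min_{AB}\Bigl(1-\max_{|\phi^A\rangle,|\phi^B\rangle}\bigl|(\langle\phi^A|\langle\phi^B|)|\psi\rangle\bigr|^2\Bigr)$$ be its multipartite entanglement, where $AB$ runs over the bipartitions of $\{1,\dots,n\}$ into two non-empty sets and $|\phi^A\rangle$, $|\phi^B\rangle$ over the unit vectors of the corresponding tensor factors. Let $\operatorname{lpf}(k)$ denote the least prime factor of an integer $k\ge 2$. Then for every positive divisor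 $m^*$ of $d$ with $m^*<d$, the number $d/\operatorname{lpf}(d/m^*)$ is of the form $\beta m^*$ with an integer $1\le\beta<d/m^*$, and $$\min_{1\le\beta<d/m^*}E(|G_n^{\beta m^*}\rangle)=E(|G_n^{d/\operatorname{lpf}(d/m^*)}\rangle).$$ Moreover, for every integer $m_e$ with $1\le m_e<d$, $$E(|G_n^{d/\operatorname{lpf}(d)}\rangle)\le E(|G_n^{m_e}\rangle)\le E(|G_n^{1}\rangle).$$ -/

import Mathlib

namespace QuditHypergraph

noncomputable section

/-- The Hilbert space `⨂_{i ∈ V} ℂ^d` of qudits labelled by `V`, in the computational basis: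
a vector is the family of its amplitudes on the basis states `|q⟩`, `q : V → {0, …, d-1}`,
with the Hilbert (`ℓ²`) inner product. -/
abbrev QuditSpace (d : ℕ) (V : Type) [Fintype V] [DecidableEq V] : Type :=
  EuclideanSpace ℂ (V → Fin d)

/-- The primitive root of unity `ω = e^{2πi/d}`. -/
def omega (d : ℕ) : ℂ := Complex.exp (2 * Real.pi * Complex.I / d)

/-- The one-qudit state `|+⟩ = d^{-1/2} ∑_q |q⟩`. -/
def plus (d : ℕ) : EuclideanSpace ℂ (Fin d) :=
  WithLp.toLp 2 fun _ => ((Real.sqrt d : ℝ) : ℂ)⁻¹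

/-- The product state `|+⟩^V = ⨂_{i ∈ V} |+⟩_i`. -/
def plusState (d : ℕ) (V : Type) [Fintype V] [DecidableEq V] : QuditSpace d V :=
  WithLp.toLp 2 fun q => ∏ i, plus d (q i)

/-- The controlled phase gate `Z_e = ∑_q ω^{∏_{i ∈ e} q_i} |q⟩⟨q|` of a hyperedge `e ⊆ V`. -/
def controlledZ (d : ℕ) {V : Type} [Fintype V] [DecidableEq V] (e : Finset V) :
    QuditSpace d V →ₗ[ℂ] QuditSpace d V where
  toFun ψ := WithLp.toLp 2 fun q => omega d ^ (∏ i ∈ e, (q i : ℕ)) * ψ q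
  map_add' ψ χ := by
    ext q
    simp [mul_add]
  map_smul' c ψ := by
    ext q
    simp [mul_left_comm]

/-- The elementary hypergraph state `|G_n^m⟩ = Z_e^m |+⟩^V`, with `V = {1, …, n}` and the single
hyperedge `e = V` of multiplicity `m`. -/
def elementaryState (d n m : ℕ) : QuditSpace d (Fin n) :=
  (controlledZ d (Finset.univ : Finset (Fin n)) ^ m) (plusState d (Fin n))

/-- The product vector `|φ^A⟩|φ^B⟩` with respect to the bipartition of `V` into `A` and its
complement `B`. -/
def productState {d : ℕ} {V : Type} [Fintype V] [DecidableEq V] (A : Finset V)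
    (φA : QuditSpace d {i // i ∈ A}) (φB : QuditSpace d {i // i ∉ A}) : QuditSpace d V :=
  WithLp.toLp 2 fun q => φA (fun i => q i) * φB (fun i => q i)

/-- `α^{AB}(ψ)`: the largest squared overlap `|⟨φ^A φ^B | ψ⟩|²` of `ψ` with a pure (unit) state
that is separable with respect to the bipartition of `V` into `A` and its complement `B`. -/
def maxOverlap {d : ℕ} {V : Type} [Fintype V] [DecidableEq V] (A : Finset V)
    (ψ : QuditSpace d V) : ℝ :=
  sSup {x : ℝ | ∃ (φA : QuditSpace d {i // i ∈ A}) (φB : QuditSpace d {i // i ∉ A}),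
    ‖φA‖ = 1 ∧ ‖φB‖ = 1 ∧ x = ‖inner ℂ (productState A φA φB) ψ‖ ^ 2}

/-- The bipartite entanglement `E^{AB}(ψ) = 1 - α^{AB}(ψ)`. -/
def bipartiteEntanglement {d : ℕ} {V : Type} [Fintype V] [DecidableEq V] (A : Finset V)
    (ψ : QuditSpace d V) : ℝ :=
  1 - maxOverlap A ψ

/-- The multipartite entanglement `E(ψ)`: the minimum of `E^{AB}(ψ)` over all the bipartitions
of `V` into two non-empty parts `A` and `B`. -/
def entanglement {d : ℕ} {V : Type} [Fintype V] [DecidableEq V] (ψ : QuditSpace d V) : ℝ :=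
  ⨅ A : {A : Finset V // A.Nonempty ∧ Aᶜ.Nonempty}, bipartiteEntanglement A.1 ψ

end

end QuditHypergraph

/-! Everything follows from the formula E = 1 - N(m)/d^(n-1) (`entanglement_elementaryState`), where
N(m) counts the z in {0, …, d-1}^(n-1) with d ∣ m ∏ z_i.

Upper bound on overlaps, for any bipartition: fix all coordinates of A but one. The sum over that
last coordinate is a Fourier transform on `ZMod d`, so Parseval bounds it by the largest
multiplicity of a frequency, which is that of frequency 0. Cauchy–Schwarz over the fixed coordinates
adds these multiplicities up to N(m) (`norm_sq_sum_omega_le`). When A is a single qudit the bound is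
attained.

It remains to compare counts. If d ∤ m, every zero of m has ∏ z_i divisible by any chosen prime q of
d / gcd(d, m). The number of z with q ∣ ∏ z_i decreases in q, and for m = d / p the zeros are
exactly the z with p ∣ ∏ z_i (`zeroCount_le_zeroCount_div`). At the other end, every zero of 1 is a
zero of m. -/

namespace QuditHypergraph

open Finset ComplexConjugate

/-! ### Characters of `ZMod d` and Cauchy–Schwarz inequalities. -/

/-- Reduction modulo `d` identifies the labels `0, …, d-1` with the residue classes. -/
noncomputable def residueEquiv (d : ℕ) [NeZero d] : Fin d ≃ ZMod d :=
  Equiv.ofBijective (fun t => ((t : ℕ) : ZMod d)) <| by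
    rw [Fintype.bijective_iff_injective_and_card]
    refine ⟨fun s t h => ?_, by simp [ZMod.card]⟩
    have := (ZMod.natCast_eq_natCast_iff' _ _ _).1 h
    rwa [Nat.mod_eq_of_lt s.2, Nat.mod_eq_of_lt t.2, ← Fin.ext_iff] at this

lemma residueEquiv_apply (d : ℕ) [NeZero d] (t : Fin d) :
    residueEquiv d t = ((t : ℕ) : ZMod d) := rfl

lemma omega_pow (d : ℕ) [NeZero d] (k : ℕ) :
    omega d ^ k = ZMod.stdAddChar ((k : ℕ) : ZMod d) := by
  have := ZMod.stdAddChar_coe (N := d) (k : ℤ)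
  rw [Int.cast_natCast] at this
  rw [this, omega, ← Complex.exp_nat_mul]
  congr 1
  push_cast
  ring

/-- Schur test: 2 h(y) h(y') ≤ h(y)² + h(y')², and each y shares its frequency with at most N
indices. -/
lemma sum_sum_ite_mul_le {Y R : Type*} [Fintype Y] [DecidableEq R] (b : Y → R) (N : ℕ)
    (hN : ∀ r, #{y | b y = r} ≤ N) (h : Y → ℝ) :
    ∑ y, ∑ y', (if b y = b y' then h y * h y' else 0) ≤ N * ∑ y, h y ^ 2 := by
  have key : ∑ y, ∑ y', (if b y = b y' then h y ^ 2 else 0) ≤ N * ∑ y, h y ^ 2 := by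
    rw [mul_sum]
    refine sum_le_sum fun y _ => ?_
    rw [← sum_filter, sum_const, nsmul_eq_mul]
    refine mul_le_mul_of_nonneg_right ?_ (sq_nonneg _)
    simpa only [eq_comm, Nat.cast_le] using hN (b y)
  have key' : ∑ y, ∑ y', (if b y = b y' then h y' ^ 2 else 0) ≤ N * ∑ y, h y ^ 2 := by
    rw [sum_comm]
    simpa only [eq_comm] using key
  have : ∑ y, ∑ y', (if b y = b y' then h y * h y' else 0) ≤
      (∑ y, ∑ y', (if b y = b y' then h y ^ 2 else 0) +
        ∑ y, ∑ y', (if b y = b y' then h y' ^ 2 else 0)) / 2 := by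
    rw [← sum_add_distrib, sum_div]
    refine sum_le_sum fun y _ => ?_
    rw [← sum_add_distrib, sum_div]
    refine sum_le_sum fun y' _ => ?_
    split_ifs
    · linarith [two_mul_le_add_sq (h y) (h y')]
    · simp
  linarith

/-- A large sieve type inequality for the characters of `ZMod d`: the frequencies `b y` may repeat
at most `N` times. -/
lemma sum_norm_sq_sum_stdAddChar_le {d : ℕ} [NeZero d] {Y : Type*} [Fintype Y] (b : Y → ZMod d)
    (N : ℕ) (hN : ∀ r, #{y | b y = r} ≤ N) (g : Y → ℂ) :
    ∑ s : ZMod d, ‖∑ y, ZMod.stdAddChar (s * b y) * g y‖ ^ 2 ≤ d * N * ∑ y, ‖g y‖ ^ 2 := by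
  -- Expand the square; orthogonality of characters kills the pairs with different frequencies.
  have key : ((∑ s : ZMod d, ‖∑ y, ZMod.stdAddChar (s * b y) * g y‖ ^ 2 : ℝ) : ℂ) =
      ∑ y, ∑ y', (if b y = b y' then (d : ℂ) * (g y * conj (g y')) else 0) := by
    push_cast
    calc _ = ∑ s : ZMod d, ∑ y, ∑ y',
          ZMod.stdAddChar (s * (b y - b y')) * (g y * conj (g y')) := by
            refine sum_congr rfl fun s _ => ?_
            rw [← Complex.mul_conj', map_sum, sum_mul_sum]
            refine sum_congr rfl fun y _ => sum_congr rfl fun y' _ => ?_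
            rw [map_mul (starRingEnd ℂ), ← AddChar.map_neg_eq_conj, mul_sub, sub_eq_add_neg,
              AddChar.map_add_eq_mul]
            ring
      _ = _ := by
            rw [sum_comm]
            refine sum_congr rfl fun y _ => ?_
            rw [sum_comm]
            refine sum_congr rfl fun y' _ => ?_
            rw [← sum_mul, AddChar.sum_mulShift _ (ZMod.isPrimitive_stdAddChar d), ZMod.card]
            simp only [sub_eq_zero]
            split_ifs <;> simp
  have h1 : (∑ s : ZMod d, ‖∑ y, ZMod.stdAddChar (s * b y) * g y‖ ^ 2 : ℝ) ≤
      ∑ y, ∑ y', (if b y = b y' then (d : ℝ) * (‖g y‖ * ‖g y'‖) else 0) := by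
    refine (Complex.norm_of_nonneg (by positivity)).symm.trans_le ?_
    rw [key]
    refine (norm_sum_le _ _).trans (sum_le_sum fun y _ => ?_)
    refine (norm_sum_le _ _).trans (sum_le_sum fun y' _ => ?_)
    split_ifs <;> simp
  have h2 := mul_le_mul_of_nonneg_left (sum_sum_ite_mul_le b N hN fun y => ‖g y‖)
    (Nat.cast_nonneg (α := ℝ) d)
  simp only [mul_sum, mul_ite, mul_zero] at h1 h2 ⊢
  refine h1.trans (h2.trans_eq ?_)
  simp only [mul_assoc]

lemma norm_sq_sum_mul_le {ι : Type*} (s : Finset ι) (f g : ι → ℂ) :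
    ‖∑ i ∈ s, f i * g i‖ ^ 2 ≤ (∑ i ∈ s, ‖f i‖ ^ 2) * ∑ i ∈ s, ‖g i‖ ^ 2 := by
  refine le_trans ?_ (sum_mul_sq_le_sq_mul_sq s (fun i => ‖f i‖) fun i => ‖g i‖)
  gcongr
  exact (norm_sum_le _ _).trans_eq (by simp)

/-- Cauchy–Schwarz for √u and √v; it assembles the bounds obtained for each choice of the fixed
coordinates. -/
lemma norm_sq_sum_le_of_norm_sq_le {ι : Type*} (s : Finset ι) (z : ι → ℂ) (u v : ι → ℝ)
    (hu : ∀ i, 0 ≤ u i) (hv : ∀ i, 0 ≤ v i) (h : ∀ i, ‖z i‖ ^ 2 ≤ u i * v i) :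
    ‖∑ i ∈ s, z i‖ ^ 2 ≤ (∑ i ∈ s, u i) * ∑ i ∈ s, v i := by
  have h1 : ‖∑ i ∈ s, z i‖ ≤ ∑ i ∈ s, √(u i) * √(v i) := by
    refine (norm_sum_le _ _).trans (sum_le_sum fun i _ => ?_)
    rw [← Real.sqrt_mul (hu i)]
    exact Real.le_sqrt_of_sq_le (h i)
  calc _ ≤ (∑ i ∈ s, √(u i) * √(v i)) ^ 2 := by gcongr
    _ ≤ _ := sum_mul_sq_le_sq_mul_sq _ _ _
    _ = _ := by simp [Real.sq_sqrt, hu, hv]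

/-! ### Counting solutions of product congruences. -/

/-- A non-empty fibre of t ↦ c t is a translate of the kernel. -/
lemma card_mul_eq_le {d : ℕ} [NeZero d] (c r : ZMod d) :
    #{t : Fin d | c * (t : ℕ) = r} ≤ #{t : Fin d | c * (t : ℕ) = 0} := by
  obtain h | ⟨t₀, h₀⟩ := ({t : Fin d | c * (t : ℕ) = r} : Finset (Fin d)).eq_empty_or_nonempty
  · simp [h]
  refine card_le_card_of_injOn
    (fun t => (residueEquiv d).symm (residueEquiv d t - residueEquiv d t₀)) ?_ ?_
  · intro t ht
    simp only [coe_filter, mem_univ, true_and, Set.mem_ofPred_eq, mem_filter] at ht h₀ ⊢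
    rw [← residueEquiv_apply, Equiv.apply_symm_apply, mul_sub, residueEquiv_apply,
      residueEquiv_apply, ht, h₀, sub_self]
  · intro t _ t' _ h
    simpa using h

/-- With every coordinate but j₀ frozen, the equation is linear in the remaining one. Some j₀ is
needed: the empty product is 1 and never vanishes with c ≠ 0. -/
lemma card_mul_prod_eq_le {d : ℕ} [NeZero d] {J : Type*} [Fintype J] [DecidableEq J] (j₀ : J)
    (c r : ZMod d) :
    #{y : J → Fin d | c * ∏ j, ((y j : ℕ) : ZMod d) = r} ≤
      #{y : J → Fin d | c * ∏ j, ((y j : ℕ) : ZMod d) = 0} := by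
  have key (r : ZMod d) : #{y : J → Fin d | c * ∏ j, ((y j : ℕ) : ZMod d) = r} =
      ∑ y : {j // j ≠ j₀} → Fin d,
        #{t : Fin d | (c * ∏ j, ((y j : ℕ) : ZMod d)) * (t : ℕ) = r} := by
    simp only [card_filter]
    rw [← (Equiv.funSplitAt j₀ (Fin d)).symm.sum_comp, Fintype.sum_prod_type_right]
    refine sum_congr rfl fun y _ => sum_congr rfl fun t _ => ?_
    rw [Fintype.prod_eq_mul_prod_subtype_ne _ j₀]
    have : ∏ j : {j // j ≠ j₀}, (((((Equiv.funSplitAt j₀ (Fin d)).symm (t, y)) j : Fin d) : ℕ) :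
        ZMod d) = ∏ j, ((y j : ℕ) : ZMod d) :=
      prod_congr rfl fun j _ => by simp [Equiv.funSplitAt, Equiv.piSplitAt, j.2]
    rw [this]
    simp [Equiv.funSplitAt, Equiv.piSplitAt, mul_comm, mul_left_comm]
  rw [key, key]
  exact sum_le_sum fun y _ => card_mul_eq_le _ _

/-- The number of `z ∈ {0, …, d-1}^ι` with `m ∏ z_i ≡ 0` modulo `d`. -/
def zeroCount (d m : ℕ) (ι : Type*) [Fintype ι] [DecidableEq ι] : ℕ :=
  #{z : ι → Fin d | d ∣ m * ∏ i, (z i : ℕ)}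

lemma zeroCount_congr (d m : ℕ) {ι κ : Type*} [Fintype ι] [DecidableEq ι] [Fintype κ]
    [DecidableEq κ] (h : Fintype.card ι = Fintype.card κ) :
    zeroCount d m ι = zeroCount d m κ := by
  obtain ⟨e⟩ := Fintype.card_eq.1 h
  simp only [zeroCount, card_filter]
  rw [← (e.arrowCongr (Equiv.refl (Fin d))).sum_comp]
  refine sum_congr rfl fun z _ => ?_
  rw [← e.prod_comp]
  simp [Equiv.arrowCongr]

lemma sum_card_eq_zeroCount (d m : ℕ) {I J : Type*} [Fintype I] [DecidableEq I] [Fintype J]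
    [DecidableEq J] :
    ∑ x : I → Fin d, #{y : J → Fin d |
      (m * ∏ i, ((x i : ℕ) : ZMod d)) * ∏ j, ((y j : ℕ) : ZMod d) = 0} =
      zeroCount d m (I ⊕ J) := by
  simp only [zeroCount, card_filter]
  rw [← (Equiv.sumArrowEquivProdArrow I J (Fin d)).symm.sum_comp, Fintype.sum_prod_type]
  refine sum_congr rfl fun x _ => sum_congr rfl fun y _ => if_congr ?_ rfl rfl
  rw [← ZMod.natCast_eq_zero_iff, Fintype.prod_sum_type]
  push_cast
  simp [Equiv.sumArrowEquivProdArrow, mul_assoc]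

/-! ### The bound for the bilinear form. -/

/-- The bilinear form with kernel `ω^{m ∏ x_i ∏ y_j}`. -/
lemma norm_sq_sum_omega_le {d : ℕ} [NeZero d] (m : ℕ) {I J : Type*} [Fintype I] [DecidableEq I]
    [Fintype J] [DecidableEq J] (i₀ : I) (j₀ : J) (f : (I → Fin d) → ℂ) (g : (J → Fin d) → ℂ) :
    ‖∑ x, ∑ y, omega d ^ (m * ((∏ i, (x i : ℕ)) * ∏ j, (y j : ℕ))) * (f x * g y)‖ ^ 2 ≤
      d * zeroCount d m ({i // i ≠ i₀} ⊕ J) * (∑ x, ‖f x‖ ^ 2) * ∑ y, ‖g y‖ ^ 2 := by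
  set e := (Equiv.funSplitAt i₀ (Fin d)).symm with he
  set B : ({i // i ≠ i₀} → Fin d) → (J → Fin d) → ZMod d :=
    fun x y => (m * ∏ i, ((x i : ℕ) : ZMod d)) * ∏ j, ((y j : ℕ) : ZMod d) with hB
  have hprod (t : Fin d) (x : {i // i ≠ i₀} → Fin d) :
      ∏ i, (e (t, x) i : ℕ) = t * ∏ i, (x i : ℕ) := by
    rw [Fintype.prod_eq_mul_prod_subtype_ne _ i₀]
    congr 1
    · simp [he, Equiv.funSplitAt, Equiv.piSplitAt]
    · exact prod_congr rfl fun j _ => by simp [he, Equiv.funSplitAt, Equiv.piSplitAt, j.2]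
  have hf : ∑ x, ‖f x‖ ^ 2 = ∑ x, ∑ t, ‖f (e (t, x))‖ ^ 2 := by
    rw [← e.sum_comp, Fintype.sum_prod_type_right]
  -- For fixed x, the coordinate t at i₀ is the Fourier variable and B x y is the frequency of y.
  have hsum : ∑ x, ∑ y, omega d ^ (m * ((∏ i, (x i : ℕ)) * ∏ j, (y j : ℕ))) * (f x * g y) =
      ∑ x, ∑ t, f (e (t, x)) *
        ∑ y, ZMod.stdAddChar (residueEquiv d t * B x y) * g y := by
    rw [← e.sum_comp, Fintype.sum_prod_type_right]
    refine sum_congr rfl fun x _ => sum_congr rfl fun t _ => ?_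
    rw [mul_sum]
    refine sum_congr rfl fun y _ => ?_
    rw [omega_pow, hprod, residueEquiv_apply, hB, ← mul_assoc, mul_comm (f _), mul_assoc]
    push_cast
    rw [show (m : ZMod d) * (t * (∏ i, ((x i : ℕ) : ZMod d)) * ∏ j, ((y j : ℕ) : ZMod d)) =
      t * (m * (∏ i, ((x i : ℕ) : ZMod d)) * ∏ j, ((y j : ℕ) : ZMod d)) by ring]
    ring
  rw [hsum, hf, ← sum_card_eq_zeroCount]
  have := norm_sq_sum_le_of_norm_sq_le univ
    (fun x => ∑ t, f (e (t, x)) * ∑ y, ZMod.stdAddChar (residueEquiv d t * B x y) * g y)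
    (fun x => d * #{y | B x y = 0} * ∑ y, ‖g y‖ ^ 2) (fun x => ∑ t, ‖f (e (t, x))‖ ^ 2)
    (fun x => by positivity) (fun x => by positivity) (fun x => by
      refine (norm_sq_sum_mul_le _ _ _).trans ?_
      rw [mul_comm]
      refine mul_le_mul_of_nonneg_right ?_ (by positivity)
      rw [(residueEquiv d).sum_comp fun s => ‖∑ y, ZMod.stdAddChar (s * B x y) * g y‖ ^ 2]
      exact sum_norm_sq_sum_stdAddChar_le _ _ (fun r => card_mul_prod_eq_le j₀ _ r) g)
  refine this.trans_eq ?_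
  rw [← sum_mul, ← mul_sum]
  push_cast
  ring

/-! ### Overlaps with product states and the entanglement formula. -/

lemma elementaryState_apply (d n m : ℕ) (q : Fin n → Fin d) :
    elementaryState d n m q =
      omega d ^ (m * ∏ i, (q i : ℕ)) * (((Real.sqrt d : ℝ) : ℂ)⁻¹) ^ n := by
  induction m with
  | zero => simp [elementaryState, plusState, plus]
  | succ m ih =>
    have : elementaryState d n (m + 1) =
        controlledZ d univ (elementaryState d n m) := by
      simp only [elementaryState, pow_succ', Module.End.mul_apply]
    rw [this]
    change omega d ^ (∏ i, (q i : ℕ)) * elementaryState d n m q = _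
    rw [ih]
    ring

lemma inner_productState_elementaryState {d n : ℕ} (m : ℕ) (A : Finset (Fin n))
    (φA : QuditSpace d {i // i ∈ A}) (φB : QuditSpace d {i // i ∉ A}) :
    inner ℂ (productState A φA φB) (elementaryState d n m) =
      (((Real.sqrt d : ℝ) : ℂ)⁻¹) ^ n * ∑ x, ∑ y,
        omega d ^ (m * ((∏ i, (x i : ℕ)) * ∏ j, (y j : ℕ))) * (conj (φA x) * conj (φB y)) := by
  rw [PiLp.inner_apply, ← (Equiv.piEquivPiSubtypeProd (· ∈ A) fun _ => Fin d).symm.sum_comp,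
    Fintype.sum_prod_type, mul_sum]
  refine sum_congr rfl fun x _ => ?_
  rw [mul_sum]
  refine sum_congr rfl fun y _ => ?_
  set q := (Equiv.piEquivPiSubtypeProd (· ∈ A) fun _ => Fin d).symm (x, y) with hq
  have hxy := (Equiv.piEquivPiSubtypeProd (· ∈ A) fun _ => Fin d).apply_symm_apply (x, y)
  rw [← hq] at hxy
  have hx : (fun i : {i // i ∈ A} => q i) = x := congrArg Prod.fst hxy
  have hy : (fun i : {i // i ∉ A} => q i) = y := congrArg Prod.snd hxy
  have hprod : ∏ i, (q i : ℕ) = (∏ i, (x i : ℕ)) * ∏ j, (y j : ℕ) := by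
    rw [← Fintype.prod_subtype_mul_prod_subtype (· ∈ A), ← hx, ← hy]
    congr!
  rw [elementaryState_apply, hprod, RCLike.inner_apply]
  change _ * conj (φA (fun i => q i) * φB (fun i => q i)) = _
  rw [hx, hy, map_mul]
  ring

lemma norm_inv_sqrt_pow_sq (d n : ℕ) :
    ‖(((Real.sqrt d : ℝ) : ℂ)⁻¹) ^ n‖ ^ 2 = ((d : ℝ) ^ n)⁻¹ := by
  rw [norm_pow, norm_inv, Complex.norm_real, Real.norm_of_nonneg (Real.sqrt_nonneg _),
    ← pow_mul, mul_comm, pow_mul, inv_pow, Real.sq_sqrt (Nat.cast_nonneg d), inv_pow]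

/-- The amplitudes contribute d^(-n) and the bilinear bound a factor d; removing i₀ leaves n - 1
coordinates whatever A is. -/
lemma norm_sq_inner_productState_le {d n : ℕ} [NeZero d] (m : ℕ) (A : Finset (Fin n))
    (hA : A.Nonempty) (hA' : Aᶜ.Nonempty) (φA : QuditSpace d {i // i ∈ A})
    (φB : QuditSpace d {i // i ∉ A}) (hφA : ‖φA‖ = 1) (hφB : ‖φB‖ = 1) :
    ‖inner ℂ (productState A φA φB) (elementaryState d n m)‖ ^ 2 ≤
      zeroCount d m (Fin (n - 1)) / (d : ℝ) ^ (n - 1) := by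
  obtain ⟨i₀, hi₀⟩ := hA
  obtain ⟨j₀, hj₀⟩ := hA'
  have hj₀ := mem_compl.1 hj₀
  have hn : n - 1 + 1 = n := Nat.succ_pred_eq_of_pos i₀.pos
  have hcard : Fintype.card ({i : {i // i ∈ A} // i ≠ ⟨i₀, hi₀⟩} ⊕ {i // i ∉ A}) =
      Fintype.card (Fin (n - 1)) := by
    have h1 := Fintype.card_subtype_compl (· ∈ A)
    have h2 := Fintype.card_subtype_compl (fun i : {i // i ∈ A} => i = ⟨i₀, hi₀⟩)
    have h3 : #A ≤ n := by simpa using card_le_univ A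
    have h4 : 1 ≤ #A := card_pos.2 ⟨i₀, hi₀⟩
    simp only [Fintype.card_coe, Fintype.card_fin, Fintype.card_subtype_eq] at h1 h2
    rw [Fintype.card_sum, h1]
    simp only [ne_eq]
    rw [h2, Fintype.card_fin]
    omega
  have key := norm_sq_sum_omega_le (d := d) m (⟨i₀, hi₀⟩ : {i // i ∈ A}) ⟨j₀, hj₀⟩
    (fun x => conj (φA x)) (fun y => conj (φB y))
  rw [zeroCount_congr d m hcard] at key
  have e1 : ∑ x, ‖conj (φA x)‖ ^ 2 = 1 := by
    simp only [RCLike.norm_conj, ← EuclideanSpace.norm_sq_eq, hφA, one_pow]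
  have e2 : ∑ y, ‖conj (φB y)‖ ^ 2 = 1 := by
    simp only [RCLike.norm_conj, ← EuclideanSpace.norm_sq_eq, hφB, one_pow]
  rw [e1, e2, mul_one, mul_one] at key
  rw [inner_productState_elementaryState, norm_mul, mul_pow, norm_inv_sqrt_pow_sq]
  have hd : (d : ℝ) ≠ 0 := NeZero.ne _
  calc _ ≤ ((d : ℝ) ^ n)⁻¹ * (d * zeroCount d m (Fin (n - 1))) := by gcongr
    _ = _ := by
      rw [← hn, pow_succ, hn]
      field_simp

/-- Take the uniform state on i₀ and the normalised indicator of the zero set Z on the rest. On Z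
all phases are 1, so the d · #Z terms add coherently. -/
lemma exists_norm_sq_inner_productState_eq {d n : ℕ} [NeZero d] (m : ℕ) (i₀ j₀ : Fin n)
    (hij : j₀ ≠ i₀) :
    ∃ (φA : QuditSpace d {i // i ∈ ({i₀} : Finset (Fin n))})
      (φB : QuditSpace d {i // i ∉ ({i₀} : Finset (Fin n))}), ‖φA‖ = 1 ∧ ‖φB‖ = 1 ∧
      zeroCount d m (Fin (n - 1)) / (d : ℝ) ^ (n - 1) =
        ‖inner ℂ (productState {i₀} φA φB) (elementaryState d n m)‖ ^ 2 := by
  have hn : n - 1 + 1 = n := Nat.succ_pred_eq_of_pos i₀.pos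
  have hcard : Fintype.card {i // i ∉ ({i₀} : Finset (Fin n))} = Fintype.card (Fin (n - 1)) := by
    rw [Fintype.card_subtype_compl]
    simp
  rw [← zeroCount_congr d m hcard]
  set J := {i // i ∉ ({i₀} : Finset (Fin n))} with hJ
  set Z : Finset (J → Fin d) := {z | d ∣ m * ∏ i, (z i : ℕ)} with hZ
  have hN : zeroCount d m J = #Z := rfl
  have hZpos : 0 < #Z := by
    refine card_pos.2 ⟨fun _ => 0, ?_⟩
    -- The second qudit j₀ makes J non-empty, so the zero vector lies in Z.
    have : ∏ _i : J, ((0 : Fin d) : ℕ) = 0 :=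
      prod_eq_zero (mem_univ ⟨j₀, by simpa using hij⟩) (by simp)
    exact mem_filter.2 ⟨mem_univ _, by rw [this]; exact dvd_zero d⟩
  have hd : 0 < (d : ℝ) := Nat.cast_pos.2 (NeZero.pos d)
  have hZ' : 0 < (#Z : ℝ) := Nat.cast_pos.2 hZpos
  refine ⟨WithLp.toLp 2 fun _ => ((Real.sqrt d : ℝ) : ℂ)⁻¹,
    WithLp.toLp 2 fun y => if y ∈ Z then ((Real.sqrt #Z : ℝ) : ℂ)⁻¹ else 0, ?_, ?_, ?_⟩
  · rw [← sq_eq_sq₀ (norm_nonneg _) zero_le_one, EuclideanSpace.norm_sq_eq]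
    have := norm_inv_sqrt_pow_sq d 1
    rw [pow_one, pow_one] at this
    simp only [this, sum_const, card_univ, Fintype.card_fun, Fintype.card_fin,
      Fintype.card_coe, card_singleton, pow_one, nsmul_eq_mul]
    field_simp
  · rw [← sq_eq_sq₀ (norm_nonneg _) zero_le_one, EuclideanSpace.norm_sq_eq]
    have := norm_inv_sqrt_pow_sq #Z 1
    rw [pow_one, pow_one] at this
    simp only [apply_ite norm, ite_pow, this, norm_zero, ne_eq, OfNat.ofNat_ne_zero,
      not_false_eq_true, zero_pow, sum_ite_mem, univ_inter, sum_const, nsmul_eq_mul]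
    field_simp
  · rw [inner_productState_elementaryState, norm_mul, mul_pow, norm_inv_sqrt_pow_sq]
    have hterm (x : {i // i ∈ ({i₀} : Finset (Fin n))} → Fin d) :
        ∑ y : J → Fin d, omega d ^ (m * ((∏ i, (x i : ℕ)) * ∏ j, (y j : ℕ))) *
          (conj (((Real.sqrt d : ℝ) : ℂ)⁻¹) *
            conj (if y ∈ Z then ((Real.sqrt #Z : ℝ) : ℂ)⁻¹ else 0)) =
        #Z * (((Real.sqrt d : ℝ) : ℂ)⁻¹ * ((Real.sqrt #Z : ℝ) : ℂ)⁻¹) := by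
      rw [← nsmul_eq_mul, ← sum_const, ← sum_subset (subset_univ Z)]
      · refine sum_congr rfl fun y hy => ?_
        have hdvd : d ∣ m * ((∏ i, (x i : ℕ)) * ∏ j, (y j : ℕ)) := by
          rw [mul_left_comm]
          exact Dvd.dvd.mul_left (mem_filter.1 hy).2 _
        rw [omega_pow, (ZMod.natCast_eq_zero_iff _ _).2 hdvd, AddChar.map_zero_eq_one, if_pos hy,
          map_inv₀, map_inv₀, Complex.conj_ofReal, Complex.conj_ofReal, one_mul]
      · intro y _ hy
        simp [hy]
    have hsum := sum_congr (rfl : (univ : Finset ({i // i ∈ ({i₀} : Finset (Fin n))} → Fin d)) = _)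
      fun x _ => hterm x
    refine Eq.trans ?_ (congrArg (fun z : ℂ => ((d : ℝ) ^ n)⁻¹ * ‖z‖ ^ 2) hsum.symm)
    simp only [sum_const, card_univ, Fintype.card_fun, Fintype.card_fin, Fintype.card_coe,
      card_singleton, pow_one, nsmul_eq_mul, norm_mul, norm_inv, Complex.norm_real,
      Complex.norm_natCast, Real.norm_of_nonneg (Real.sqrt_nonneg _), mul_pow, inv_pow,
      Real.sq_sqrt hd.le, Real.sq_sqrt hZ'.le]
    have hpow : (d : ℝ) ^ n = d ^ (n - 1) * d := by rw [← pow_succ, hn]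
    have hN' : (zeroCount d m {i // i ∉ ({i₀} : Finset (Fin n))} : ℝ) = #Z := congrArg _ hN
    rw [hpow, hN']
    field_simp

lemma maxOverlap_elementaryState_le {d n : ℕ} [NeZero d] (m : ℕ) (A : Finset (Fin n))
    (hA : A.Nonempty) (hA' : Aᶜ.Nonempty) :
    maxOverlap A (elementaryState d n m) ≤
      zeroCount d m (Fin (n - 1)) / (d : ℝ) ^ (n - 1) := by
  unfold maxOverlap
  -- Nonnegativity of the bound covers the default value `sSup ∅ = 0`.
  refine Real.sSup_le ?_ (by positivity)
  rintro _ ⟨φA, φB, hφA, hφB, rfl⟩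
  exact norm_sq_inner_productState_le m A hA hA' φA φB hφA hφB

lemma le_maxOverlap_singleton_elementaryState {d n : ℕ} [NeZero d] (m : ℕ) (i₀ j₀ : Fin n)
    (hij : j₀ ≠ i₀) :
    zeroCount d m (Fin (n - 1)) / (d : ℝ) ^ (n - 1) ≤
      maxOverlap {i₀} (elementaryState d n m) := by
  unfold maxOverlap
  refine le_csSup ⟨zeroCount d m (Fin (n - 1)) / (d : ℝ) ^ (n - 1), ?_⟩ ?_
  · rintro _ ⟨φA, φB, hφA, hφB, rfl⟩
    exact norm_sq_inner_productState_le m _ (singleton_nonempty _) ⟨j₀, by simpa using hij⟩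
      φA φB hφA hφB
  · exact exists_norm_sq_inner_productState_eq m i₀ j₀ hij

/-- The entanglement of an elementary hypergraph state is that of the bipartitions that separate
a single qudit. -/
lemma entanglement_elementaryState {d n : ℕ} [NeZero d] (m : ℕ) (hn : 2 ≤ n) :
    entanglement (elementaryState d n m) =
      1 - zeroCount d m (Fin (n - 1)) / (d : ℝ) ^ (n - 1) := by
  obtain ⟨j₀, i₀, hij⟩ : ∃ j₀ i₀ : Fin n, j₀ ≠ i₀ :=
    ⟨⟨1, hn⟩, ⟨0, zero_lt_two.trans_le hn⟩, by simp⟩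
  have hA₀ : ({i₀} : Finset (Fin n)).Nonempty ∧ ({i₀} : Finset (Fin n))ᶜ.Nonempty :=
    ⟨singleton_nonempty _, j₀, by simpa using hij⟩
  have : Nonempty {A : Finset (Fin n) // A.Nonempty ∧ Aᶜ.Nonempty} := ⟨⟨_, hA₀⟩⟩
  unfold entanglement bipartiteEntanglement
  apply le_antisymm
  · refine (ciInf_le (Set.finite_range _).bddBelow ⟨{i₀}, hA₀⟩).trans ?_
    linarith [le_maxOverlap_singleton_elementaryState (d := d) m i₀ j₀ hij]
  · refine le_ciInf fun A => ?_
    linarith [maxOverlap_elementaryState_le (d := d) m A.1 A.2.1 A.2.2]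

lemma entanglement_le_iff {d n : ℕ} [NeZero d] (m m' : ℕ) (hn : 2 ≤ n) :
    entanglement (elementaryState d n m) ≤ entanglement (elementaryState d n m') ↔
      zeroCount d m' (Fin (n - 1)) ≤ zeroCount d m (Fin (n - 1)) := by
  have hd : 0 < (d : ℝ) ^ (n - 1) := pow_pos (Nat.cast_pos.2 (NeZero.pos d)) _
  rw [entanglement_elementaryState m hn, entanglement_elementaryState m' hn,
    sub_le_sub_iff_left, div_le_div_iff_of_pos_right hd, Nat.cast_le]

/-! ### Comparing the counts for different multiplicities. -/

lemma card_fin_dvd {d q : ℕ} (hd : d ≠ 0) (hq : q ∣ d) : #{t : Fin d | q ∣ (t : ℕ)} = d / q := by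
  obtain ⟨k, rfl⟩ := hq
  have hq0 : 0 < q := Nat.pos_of_ne_zero (left_ne_zero_of_mul hd)
  rw [Nat.mul_div_cancel_left _ hq0]
  refine Eq.trans (card_bij (t := range k) (fun t _ => (t : ℕ) / q) ?_ ?_ ?_) (card_range k)
  · intro t _
    exact mem_range.2 (Nat.div_lt_of_lt_mul t.2)
  · intro s hs t ht h
    exact Fin.ext (Nat.div_left_inj (mem_filter.1 hs).2 (mem_filter.1 ht).2 |>.1 h)
  · intro b hb
    refine ⟨⟨q * b, Nat.mul_lt_mul_of_pos_left (mem_range.1 hb) hq0⟩, by simp, ?_⟩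
    exact Nat.mul_div_cancel_left _ hq0

/-- By primality, q misses the product exactly when it misses every coordinate, so the complement is
a power. -/
lemma card_prime_dvd_prod {d q : ℕ} (hd : d ≠ 0) (hq : q.Prime) (hqd : q ∣ d) (ι : Type*)
    [Fintype ι] [DecidableEq ι] :
    #{z : ι → Fin d | q ∣ ∏ i, (z i : ℕ)} =
      d ^ Fintype.card ι - (d - d / q) ^ Fintype.card ι := by
  have h1 : #{t : Fin d | ¬ q ∣ (t : ℕ)} = d - d / q := by
    have := card_filter_add_card_filter_not (s := (univ : Finset (Fin d)))
      (fun t : Fin d => q ∣ (t : ℕ))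
    rw [card_fin_dvd hd hqd, card_univ, Fintype.card_fin] at this
    omega
  have h2 : #{z : ι → Fin d | ¬ q ∣ ∏ i, (z i : ℕ)} = (d - d / q) ^ Fintype.card ι := by
    rw [← h1, ← card_univ, ← prod_const, ← Fintype.card_piFinset]
    refine congrArg card (Finset.ext fun z => ?_)
    simp [hq.prime.dvd_finsetProd_iff]
  have := card_filter_add_card_filter_not (s := (univ : Finset (ι → Fin d)))
    (fun z => q ∣ ∏ i, (z i : ℕ))
  rw [h2, card_univ, Fintype.card_fun, Fintype.card_fin] at this
  omega

/-- Among the multiplicities that are not multiples of `d`, those of the form `d / p` with `p`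
a small prime have the largest count of zeros. -/
lemma zeroCount_le_zeroCount_div {d m p : ℕ} (hd : d ≠ 0) (hp : p.Prime) (hpd : p ∣ d)
    (hm : ¬ d ∣ m) (hmin : ∀ q, q.Prime → q ∣ d / d.gcd m → p ≤ q) (ι : Type*)
    [Fintype ι] [DecidableEq ι] :
    zeroCount d m ι ≤ zeroCount d (d / p) ι := by
  have hg : 0 < d.gcd m := Nat.gcd_pos_of_pos_left _ (Nat.pos_of_ne_zero hd)
  have hne : d / d.gcd m ≠ 1 := by
    intro h
    have := Nat.div_mul_cancel (Nat.gcd_dvd_left d m)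
    rw [h, one_mul] at this
    exact hm (this ▸ Nat.gcd_dvd_right d m)
  obtain ⟨q, hq, hqd⟩ := Nat.exists_prime_and_dvd hne
  have hqd' : q ∣ d := hqd.trans (Nat.div_dvd_of_dvd (Nat.gcd_dvd_left d m))
  have h1 : zeroCount d m ι ≤ #{z : ι → Fin d | q ∣ ∏ i, (z i : ℕ)} := by
    refine card_le_card (monotone_filter_right _ fun z _ hz => hqd.trans ?_)
    -- Cancelling gcd(d, m) and then the coprime factor m / gcd(d, m) leaves d / gcd(d, m) ∣ ∏ z_i.
    have hcop := Nat.coprime_div_gcd_div_gcd hg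
    refine hcop.dvd_of_dvd_mul_left ?_
    rw [Nat.div_mul_right_comm (Nat.gcd_dvd_right d m)]
    exact Nat.div_dvd_div (Nat.gcd_dvd_left d m) hz
  have h2 : zeroCount d (d / p) ι = #{z : ι → Fin d | p ∣ ∏ i, (z i : ℕ)} := by
    refine congrArg card (filter_congr fun z _ => ?_)
    have hpos : 0 < d / p := Nat.div_pos (Nat.le_of_dvd (Nat.pos_of_ne_zero hd) hpd) hp.pos
    have := Nat.mul_dvd_mul_iff_left (b := p) (c := ∏ i, (z i : ℕ)) hpos
    rwa [Nat.div_mul_cancel hpd] at this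
  rw [h2]
  refine h1.trans ?_
  rw [card_prime_dvd_prod hd hq hqd', card_prime_dvd_prod hd hp hpd]
  -- p ≤ q gives d / q ≤ d / p, and d^k - (d - x)^k increases with x.
  have := Nat.div_le_div_left (a := d) (hmin q hq hqd) hp.pos
  gcongr

lemma zeroCount_one_le (d m : ℕ) (ι : Type*) [Fintype ι] [DecidableEq ι] :
    zeroCount d 1 ι ≤ zeroCount d m ι :=
  card_le_card (monotone_filter_right _ fun z _ hz => by
    rw [one_mul] at hz
    exact hz.mul_left m)

lemma exists_mul_eq_div_minFac {d m : ℕ} (hd : d ≠ 0) (hmd : m ∣ d) (hm : m < d) :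
    ∃ β ∈ Set.Ico 1 (d / m), β * m = d / (d / m).minFac := by
  obtain ⟨k, rfl⟩ := hmd
  have hm0 : 0 < m := Nat.pos_of_ne_zero (left_ne_zero_of_mul hd)
  have hk0 : 0 < k := Nat.pos_of_ne_zero (right_ne_zero_of_mul hd)
  have hk1 : k ≠ 1 := by
    rintro rfl
    simp at hm
  rw [Nat.mul_div_cancel_left _ hm0]
  have hp := Nat.minFac_prime hk1
  refine ⟨k / k.minFac, ⟨Nat.div_pos (Nat.minFac_le hk0) hp.pos,
    Nat.div_lt_self hk0 hp.one_lt⟩, ?_⟩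
  rw [Nat.mul_div_assoc _ (Nat.minFac_dvd k), mul_comm]

lemma entanglement_div_minFac_le {d n m β : ℕ} (hd : d ≠ 0) (hn : 2 ≤ n) (hmd : m ∣ d)
    (hβ : 1 ≤ β) (hβ' : β < d / m) :
    entanglement (elementaryState d n (d / (d / m).minFac)) ≤
      entanglement (elementaryState d n (β * m)) := by
  have : NeZero d := ⟨hd⟩
  have hm0 : 0 < m := Nat.pos_of_dvd_of_pos hmd (Nat.pos_of_ne_zero hd)
  rw [entanglement_le_iff _ _ hn]
  have hdm : d / m ∣ d := Nat.div_dvd_of_dvd hmd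
  refine zeroCount_le_zeroCount_div hd (Nat.minFac_prime (by omega))
    ((Nat.minFac_dvd _).trans hdm) ?_ ?_ _
  · intro h
    have := Nat.le_of_dvd (Nat.mul_pos hβ hm0) h
    exact absurd ((Nat.lt_div_iff_mul_lt' hmd β).1 hβ') (by linarith [mul_comm β m])
  · intro q hq hqd
    refine Nat.minFac_le_of_dvd hq.two_le (hqd.trans ?_)
    -- Hence d / gcd(d, β m) divides d / m, and its primes are at least the least prime factor of d
    -- / m.
    have hg : m ∣ d.gcd (β * m) := Nat.dvd_gcd hmd (dvd_mul_left _ _)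
    exact Nat.div_dvd_div_left (Nat.gcd_dvd_left _ _) hg

end QuditHypergraph

theorem mainTheorem6 (d n : ℕ) (hd : 2 ≤ d) (hn : 2 ≤ n) :
    (∀ m' : ℕ, m' ∣ d → m' < d →
      (∃ β ∈ Set.Ico 1 (d / m'), β * m' = d / (d / m').minFac) ∧
      IsLeast
        ((fun β : ℕ => QuditHypergraph.entanglement
            (QuditHypergraph.elementaryState d n (β * m'))) '' Set.Ico 1 (d / m'))
        (QuditHypergraph.entanglement
          (QuditHypergraph.elementaryState d n (d / (d / m').minFac)))) ∧
    (∀ m : ℕ, 1 ≤ m → m < d →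
      QuditHypergraph.entanglement (QuditHypergraph.elementaryState d n (d / d.minFac)) ≤
          QuditHypergraph.entanglement (QuditHypergraph.elementaryState d n m) ∧
        QuditHypergraph.entanglement (QuditHypergraph.elementaryState d n m) ≤
          QuditHypergraph.entanglement (QuditHypergraph.elementaryState d n 1)) := by
  have hd0 : d ≠ 0 := by omega
  have : NeZero d := ⟨hd0⟩
  refine ⟨fun m' hmd hm => ?_, fun m hm1 hm => ⟨?_, ?_⟩⟩
  · have hex := QuditHypergraph.exists_mul_eq_div_minFac hd0 hmd hm
    refine ⟨hex, ?_, ?_⟩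
    · obtain ⟨β, hβ, h⟩ := hex
      exact ⟨β, hβ, by simp only [h]⟩
    · rintro _ ⟨β, hβ, rfl⟩
      exact QuditHypergraph.entanglement_div_minFac_le hd0 hn hmd hβ.1 hβ.2
  -- The divisor 1 with β = m.
  · have := QuditHypergraph.entanglement_div_minFac_le hd0 hn (one_dvd d) hm1
      (by rwa [Nat.div_one])
    rwa [Nat.div_one, mul_one] at this
  · rw [QuditHypergraph.entanglement_le_iff _ _ hn]
    exact QuditHypergraph.zeroCount_one_le d m _
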